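/- Let $G=(V,E)$ be a locally finite (simple) graph. Let $\Omega$ be its set of ends, i.e. the classes of rays of $G$ under the relation that, for every finite $S\subseteq V$, the two rays have tails in the same component of $G-S$. Let $|G|$ be the set consisting of all points of the $1$-complex $G$ and all ends, with the topology generated by the open sets of the $1$-complex together with all sets $$C(S,\omega)\cup\Omega(S,\omega)\cup E'(S,\omega),$$ where $S\subseteq V$ is finite, $\omega\in\Omega$, $C(S,\omega)$ is the component of $G-S$ containing a tail of every ray of $\omega$, $\Omega(S,\omega)$ is the set of ends with a ray in $C(S,\omega)$, and $E'(S,\omega)$ is any union of half-edges $(z,y]$, one for every edge $e=xy$ with $x\in S$ and $y\in C(S,\omega)$, with $z$ an inner point of $e$. An arc in $|G|$ is a homeomorphic image of $[0,1]$ or a single point. Let $\ell$ assign to every edge $e$ a real length $\ell(e)>0$, and regard each edge as an interval of that length. The length of an arc $A$ is $\ell(A)=\sum_{e\in E}\ell(e\cap A)\in[0,\infty]$, where $\ell(e\cap A)$ is the total length of the subintervals of $e$ forming $e\cap A$, and $d_\ell(x,y)$ is the infimum of the lengths of all $x$–$y$ arcs in $|G|$. Assume that $(|G|,\ell)$ is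 a metric representation of $G$, i.e. that $d_\ell$ is a (finite) metric on $|G|$ that induces the topology of $|G|$. Then for any two distinct points $x,y\in V\cup\Omega$ there is an $x$–$y$ arc in $|G|$ of length exactly $d_\ell(x,y)$. -/

import Mathlib

open Set Filter Topology MeasureTheory
open scoped ENNReal

namespace GraphEnds

universe u

variable {V : Type u} {G : SimpleGraph V}

/-- A ray of `G`, that is, a one-way infinite path `v₀ v₁ v₂ …`. -/
structure Ray (G : SimpleGraph V) where
  vert : ℕ → V
  injective : Function.Injective vert
  adj : ∀ n, G.Adj (vert n) (vert (n + 1))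

/-- The component `C` of `G - S` contains a tail of the ray `R`. -/
def Ray.HasTailIn (R : Ray G) {S : Set V} (C : G.ComponentCompl S) : Prop :=
  ∀ᶠ n in atTop, R.vert n ∈ C

theorem Ray.exists_hasTailIn (R : Ray G) (S : Finset V) :
    ∃ C : G.ComponentCompl (S : Set V), R.HasTailIn C := by
  have h1 : ∀ᶠ n in atTop, R.vert n ∉ (S : Set V) := by
    have := R.injective.tendsto_cofinite.eventually (S.finite_toSet.compl_mem_cofinite)
    rwa [Nat.cofinite_eq_atTop] at this
  obtain ⟨N, hN⟩ := eventually_atTop.1 h1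
  refine ⟨G.componentComplMk (hN N le_rfl), eventually_atTop.2 ⟨N, fun n hn => ?_⟩⟩
  induction n, hn using Nat.le_induction with
  | base => exact G.componentComplMk_mem _
  | succ n hn ih =>
    exact SimpleGraph.ComponentCompl.mem_of_adj _ _ ih (hN _ (by omega)) (R.adj n)

theorem Ray.HasTailIn.unique {R : Ray G} {S : Set V} {C D : G.ComponentCompl S}
    (hC : R.HasTailIn C) (hD : R.HasTailIn D) : C = D := by
  obtain ⟨n, h1, h2⟩ := (hC.and hD).exists
  obtain ⟨_, h1⟩ := h1
  obtain ⟨_, h2⟩ := h2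
  exact h1.symm.trans h2

/-- Two rays are equivalent if no finite set `S` of vertices separates them, that is, if for every
finite `S` they have tails in the same component of `G - S`. -/
instance raySetoid (G : SimpleGraph V) : Setoid (Ray G) where
  r R L := ∀ S : Finset V, ∃ C : G.ComponentCompl (S : Set V), R.HasTailIn C ∧ L.HasTailIn C
  iseqv :=
    { refl := fun R S => (R.exists_hasTailIn S).imp fun _ h => ⟨h, h⟩
      symm := fun h S => (h S).imp fun _ h => ⟨h.2, h.1⟩
      trans := fun h k S => by
        obtain ⟨C, h1, h2⟩ := h S
        obtain ⟨D, k1, k2⟩ := k S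
        obtain rfl := h2.unique k1
        exact ⟨C, h1, k2⟩ }

/-- The ends of `G`: equivalence classes of rays. -/
def GraphEnd (G : SimpleGraph V) : Type u := Quotient (raySetoid G)

/-- The end containing a given ray. -/
def Ray.toEnd (R : Ray G) : GraphEnd G := Quotient.mk (raySetoid G) R

/-- The vertex set of `C(S, ω)`, the component of `G - S` that contains a tail of some ray
in `ω`. -/
def endComp (S : Finset V) (ω : GraphEnd G) : Set V :=
  {v | ∃ R : Ray G, R.toEnd = ω ∧ ∃ C : G.ComponentCompl (S : Set V), R.HasTailIn C ∧ v ∈ C}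

/-- `Ω(S, ω)`: the set of all ends that have a ray in `C(S, ω)`. -/
def endsInComp (S : Finset V) (ω : GraphEnd G) : Set (GraphEnd G) :=
  {ω' | ∃ R : Ray G, R.toEnd = ω' ∧ ∀ n, R.vert n ∈ endComp S ω}

/-- The two endvertices of an edge, in an order fixed once and for all. The order serves only to
parametrize the edge. -/
noncomputable def edgeTail (e : G.edgeSet) : V := (Quot.out (e : Sym2 V)).1

/-- The second of the two endvertices of an edge, see `edgeTail`. -/
noncomputable def edgeHead (e : G.edgeSet) : V := (Quot.out (e : Sym2 V)).2

/-- The points of `|G|`: the vertices, the inner points of the edges (each open edge being a copy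
of the open interval `(0, 1)`), and the ends. -/
inductive EndSpace (G : SimpleGraph V) : Type u
  | vertex (v : V) : EndSpace G
  | inner (e : G.edgeSet) (t : Ioo (0 : ℝ) 1) : EndSpace G
  | ofEnd (ω : GraphEnd G) : EndSpace G

namespace EndSpace

open Classical in
/-- The parametrization of the closed edge `e` by `[0, 1]`, from its tail to its head
(constant outside `[0, 1]`). -/
noncomputable def edgePt (e : G.edgeSet) (t : ℝ) : EndSpace G :=
  if h : t ∈ Ioo (0 : ℝ) 1 then inner e ⟨t, h⟩
  else if t ≤ 0 then vertex (edgeTail e) else vertex (edgeHead e)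

/-- The underlying point set of the 1-complex `G` inside `|G|`: everything but the ends. -/
def complexPts (G : SimpleGraph V) : Set (EndSpace G) := (range ofEnd)ᶜ

/-- `U` is an open set of the 1-complex `G`: a set of vertices and inner points of edges whose
trace on every closed edge is open in that edge. -/
def IsComplexOpen (U : Set (EndSpace G)) : Prop :=
  U ⊆ complexPts G ∧ ∀ e : G.edgeSet, IsOpen {t : unitInterval | edgePt e (t : ℝ) ∈ U}

/-- The component `C(S, ω)` as a subcomplex: its vertices and all the inner points of its edges. -/
def compPts (S : Finset V) (ω : GraphEnd G) : Set (EndSpace G) :=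
  {p | (∃ v ∈ endComp S ω, p = vertex v) ∨
    ∃ (e : G.edgeSet) (t : Ioo (0 : ℝ) 1),
      edgeTail e ∈ endComp S ω ∧ edgeHead e ∈ endComp S ω ∧ p = inner e t}

/-- `E'(S, ω)`: the union of the half-edges `(z, y]`, one for every edge `xy` with `x ∈ S` and
`y ∈ C(S, ω)`, where `z e` is a given inner point of the edge `e`. -/
def halfEdges (S : Finset V) (ω : GraphEnd G) (z : G.edgeSet → Ioo (0 : ℝ) 1) :
    Set (EndSpace G) :=
  {p | ∃ (e : G.edgeSet) (t : ℝ), t ∈ Icc (0 : ℝ) 1 ∧ p = edgePt e t ∧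
    ((edgeTail e ∈ S ∧ edgeHead e ∈ endComp S ω ∧ (z e : ℝ) < t) ∨
      (edgeHead e ∈ S ∧ edgeTail e ∈ endComp S ω ∧ t < (z e : ℝ)))}

/-- The basic open neighbourhoods `C(S, ω) ∪ Ω(S, ω) ∪ E'(S, ω)` of the end `ω`. -/
def basicNhd (S : Finset V) (ω : GraphEnd G) (z : G.edgeSet → Ioo (0 : ℝ) 1) :
    Set (EndSpace G) :=
  compPts S ω ∪ ofEnd '' endsInComp S ω ∪ halfEdges S ω z

/-- The topology of `|G|`, generated by the open sets of the 1-complex `G` and the basic open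
neighbourhoods of the ends. -/
instance : TopologicalSpace (EndSpace G) :=
  TopologicalSpace.generateFrom
    ({U | IsComplexOpen U} ∪ {U | ∃ S ω z, U = basicNhd S ω z})

/-- `V ∪ Ω`, the set of vertices and ends. -/
def verticesAndEnds (G : SimpleGraph V) : Set (EndSpace G) := range vertex ∪ range ofEnd

/-- `A` is an `x`–`y` arc in `|G|`: a homeomorphic image of the unit interval with endpoints `x`
and `y`, or a single point `x = y`. -/
def IsArc (x y : EndSpace G) (A : Set (EndSpace G)) : Prop :=
  (∃ f : unitInterval → EndSpace G, IsEmbedding f ∧ f 0 = x ∧ f 1 = y ∧ range f = A) ∨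
    (x = y ∧ A = {x})

/-- The length `∑ₑ ℓ(e ∩ A)` of an arc `A`, in `[0, ∞]`, when each edge `e` is regarded as an
interval of length `ℓ e`. Here `e ∩ A` is a finite union of intervals and `ℓ(e ∩ A)` is its total
length. -/
noncomputable def arcLength (ℓ : G.edgeSet → ℝ) (A : Set (EndSpace G)) : ℝ≥0∞ :=
  ∑' e : G.edgeSet,
    ENNReal.ofReal (ℓ e) * volume {t : ℝ | t ∈ Icc (0 : ℝ) 1 ∧ edgePt e t ∈ A}

/-- `d_ℓ(x, y)`: the infimum of the lengths of all `x`–`y` arcs (`∞` if there is none). -/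
noncomputable def arcDist (ℓ : G.edgeSet → ℝ) (x y : EndSpace G) : ℝ≥0∞ :=
  ⨅ (A : Set (EndSpace G)) (_ : IsArc x y A), arcLength ℓ A

/-- `(|G|, ℓ)` is a metric representation of `G`: the edge lengths are positive, and `d_ℓ` is a
(finite) metric on `|G|` that induces the topology of `|G|`. -/
def IsMetricRepresentation (G : SimpleGraph V) (ℓ : G.edgeSet → ℝ) : Prop :=
  (∀ e, 0 < ℓ e) ∧
    ∃ m : MetricSpace (EndSpace G),
      (∀ x y, arcDist ℓ x y = ENNReal.ofReal (m.dist x y)) ∧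
        m.toUniformSpace.toTopologicalSpace = (inferInstance : TopologicalSpace (EndSpace G))

end EndSpace

end GraphEnds

/-! The space `|G|` is compact, so its length metric is realised by metric geodesics; what remains
is that the edge length of a geodesic does not exceed its metric length.

Finiteness of `d_ℓ` makes `|G|` connected, hence `G` connected, and for connected locally finite `G`
a König argument with ultrafilters gives compactness (`compactSpace`). Cutting nearly shortest arcs
yields approximate intermediate points (`exists_approx_between`). Compactness makes them exact, and
Tychonoff's theorem assembles them into a map `f` on `[0, 1]` with `d (f s) (f t) = L * |s - t|`,
where `L = d x y` (`HasBetween.exists_geodesic`). Since `x ≠ y`, `f` is injective, so its image `A`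
is an arc.

The length of `A` is at least `L` because `d_ℓ` is an infimum. Conversely, `d_ℓ` dominates length
along short segments of an edge (`mul_abs_sub_le_dist_edgePt`), so `ℓ(e ∩ A)` is at most `L` times
the time that `f` spends inside `e`. The times for different edges are disjoint parts of `[0, 1]`,
so the total is at most `L` (`arcLength_range_le`). Time spent at ends or vertices is simply
discarded. -/

namespace GraphEnds

universe u

variable {V : Type u} {G : SimpleGraph V}

/-! ### Rays and components -/

theorem Ray.mem_of_hasTailIn {R : Ray G} {S : Set V} {C : G.ComponentCompl S}
    (h : R.HasTailIn C) {N : ℕ} (hN : ∀ n, N ≤ n → R.vert n ∉ S) {n : ℕ} (hn : N ≤ n) :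
    R.vert n ∈ C := by
  have key : ∀ m, N ≤ m → R.vert m ∈ G.componentComplMk (hN N le_rfl) := by
    intro m hm
    induction m, hm using Nat.le_induction with
    | base => exact G.componentComplMk_mem _
    | succ m hm ih =>
      exact SimpleGraph.ComponentCompl.mem_of_adj _ _ ih (hN _ (by omega)) (R.adj m)
  have h' : R.HasTailIn (G.componentComplMk (hN N le_rfl)) := eventually_atTop.2 ⟨N, key⟩
  rw [h.unique h']
  exact key n hn

theorem componentCompl_eq_of_mem {S : Set V} {C D : G.ComponentCompl S} {v : V}
    (hC : v ∈ C) (hD : v ∈ D) : C = D := by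
  obtain ⟨_, h1⟩ := hC
  obtain ⟨_, h2⟩ := hD
  exact h1.symm.trans h2

theorem Ray.toEnd_eq_iff {R L : Ray G} : R.toEnd = L.toEnd ↔
    ∀ S : Finset V, ∃ C : G.ComponentCompl (S : Set V), R.HasTailIn C ∧ L.HasTailIn C :=
  Quotient.eq

/-- Equivalent rays have tails in the same component, so the ray chosen in the definition of
`endComp` does not matter, and `endComp S ω` is a single component. -/
theorem mem_endComp_iff {S : Finset V} {R : Ray G} {C : G.ComponentCompl (S : Set V)}
    (h : R.HasTailIn C) {v : V} : v ∈ endComp S R.toEnd ↔ v ∈ C := by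
  constructor
  · rintro ⟨L, hL, D, hD, hv⟩
    obtain ⟨E, h1, h2⟩ := Ray.toEnd_eq_iff.1 hL S
    rwa [← h2.unique h, h1.unique hD]
  · exact fun hv => ⟨R, rfl, C, h, hv⟩

theorem exists_endComp_eq (S : Finset V) (ω : GraphEnd G) :
    ∃ C : G.ComponentCompl (S : Set V), ∀ v, v ∈ endComp S ω ↔ v ∈ C := by
  obtain ⟨R, rfl⟩ := Quotient.exists_rep ω
  obtain ⟨C, hC⟩ := R.exists_hasTailIn S
  exact ⟨C, fun v => mem_endComp_iff hC⟩

theorem mem_endComp_of_adj {S : Finset V} {ω : GraphEnd G} {u v : V} (hu : u ∈ endComp S ω)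
    (hv : v ∉ S) (h : G.Adj u v) : v ∈ endComp S ω := by
  obtain ⟨C, hC⟩ := exists_endComp_eq S ω
  rw [hC] at hu ⊢
  exact SimpleGraph.ComponentCompl.mem_of_adj _ _ hu (by simpa using hv) h

theorem notMem_of_mem_endComp {S : Finset V} {ω : GraphEnd G} {v : V}
    (hv : v ∈ endComp S ω) : v ∉ S := by
  obtain ⟨C, hC⟩ := exists_endComp_eq S ω
  obtain ⟨h, -⟩ := (hC v).1 hv
  exact h

theorem reachable_of_mem_componentCompl {S : Set V} {C : G.ComponentCompl S} {u v : V}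
    (hu : u ∈ C) (hv : v ∈ C) : G.Reachable u v := by
  obtain ⟨h1, rfl⟩ := hu
  obtain ⟨h2, h⟩ := hv
  have := SimpleGraph.ConnectedComponent.exact h
  exact (this.map (SimpleGraph.Embedding.induce Sᶜ).toHom).symm

theorem reachable_of_mem_endComp {S : Finset V} {ω : GraphEnd G} {u v : V}
    (hu : u ∈ endComp S ω) (hv : v ∈ endComp S ω) : G.Reachable u v := by
  obtain ⟨C, hC⟩ := exists_endComp_eq S ω
  exact reachable_of_mem_componentCompl ((hC _).1 hu) ((hC _).1 hv)

theorem Ray.eventually_mem_endComp (R : Ray G) (S : Finset V) :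
    ∀ᶠ n in atTop, R.vert n ∈ endComp S R.toEnd := by
  obtain ⟨C, hC⟩ := R.exists_hasTailIn S
  exact hC.mono fun n hn => (mem_endComp_iff hC).2 hn

/-- If an end lies in `Ω(S, ω)`, then each of its rays runs in `C(S, ω)` as soon as it has
left `S` for good. -/
theorem Ray.mem_endComp_of_toEnd_mem {R : Ray G} {S : Finset V} {ω : GraphEnd G}
    (h : R.toEnd ∈ endsInComp S ω) {N : ℕ} (hN : ∀ n, N ≤ n → R.vert n ∉ S) {n : ℕ}
    (hn : N ≤ n) : R.vert n ∈ endComp S ω := by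
  obtain ⟨L, hL, hLω⟩ := h
  obtain ⟨C, hC⟩ := exists_endComp_eq S ω
  obtain ⟨D, h1, h2⟩ := Ray.toEnd_eq_iff.1 hL S
  have : D = C := h1.unique (Eventually.of_forall fun n => (hC _).1 (hLω n))
  subst this
  exact (hC _).2 (R.mem_of_hasTailIn h2 (by simpa using hN) hn)

/-- The ray `R` without its first `N` vertices. -/
def Ray.drop (R : Ray G) (N : ℕ) : Ray G where
  vert n := R.vert (n + N)
  injective a b h := by simpa using R.injective h
  adj n := by
    have := R.adj (n + N)
    rwa [show n + N + 1 = n + 1 + N by omega] at this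

theorem Ray.toEnd_drop (R : Ray G) (N : ℕ) : (R.drop N).toEnd = R.toEnd := by
  rw [Ray.toEnd_eq_iff]
  intro S
  obtain ⟨C, hC⟩ := R.exists_hasTailIn S
  exact ⟨C, (tendsto_add_atTop_nat N).eventually hC, hC⟩

theorem toEnd_mem_endsInComp {R : Ray G} {S : Finset V} {ω : GraphEnd G} {N : ℕ}
    (h : ∀ n, N ≤ n → R.vert n ∈ endComp S ω) : R.toEnd ∈ endsInComp S ω :=
  ⟨R.drop N, R.toEnd_drop N, fun _ => h _ (Nat.le_add_left _ _)⟩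

theorem mem_endsInComp_self (S : Finset V) (ω : GraphEnd G) : ω ∈ endsInComp S ω := by
  obtain ⟨R, rfl⟩ := Quotient.exists_rep ω
  obtain ⟨N, hN⟩ := eventually_atTop.1 (R.eventually_mem_endComp S)
  exact toEnd_mem_endsInComp hN

theorem adj_edge (e : G.edgeSet) : G.Adj (edgeTail e) (edgeHead e) := by
  have h : s(edgeTail e, edgeHead e) = (e : Sym2 V) := Quot.out_eq (e : Sym2 V)
  rw [← SimpleGraph.mem_edgeSet, h]
  exact e.2

theorem edge_ext {e e' : G.edgeSet} (h1 : edgeTail e = edgeTail e')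
    (h2 : edgeHead e = edgeHead e') : e = e' := by
  have h : ∀ e : G.edgeSet, s(edgeTail e, edgeHead e) = (e : Sym2 V) :=
    fun e => Quot.out_eq (e : Sym2 V)
  exact Subtype.ext (by rw [← h e, ← h e', h1, h2])

namespace EndSpace

/-! ### Edges as subspaces -/

theorem edgePt_of_nonpos (e : G.edgeSet) {t : ℝ} (ht : t ≤ 0) :
    edgePt e t = vertex (edgeTail e) := by
  rw [edgePt, dif_neg (fun h => absurd h.1 (not_lt.2 ht)), if_pos ht]

theorem edgePt_of_one_le (e : G.edgeSet) {t : ℝ} (ht : 1 ≤ t) :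
    edgePt e t = vertex (edgeHead e) := by
  rw [edgePt, dif_neg (fun h => absurd h.2 (not_lt.2 ht)), if_neg (by linarith)]

theorem edgePt_of_mem (e : G.edgeSet) {t : ℝ} (ht : t ∈ Ioo (0 : ℝ) 1) :
    edgePt e t = inner e ⟨t, ht⟩ := dif_pos ht

theorem edgePt_trichotomy (t : ℝ) : t ≤ 0 ∨ t ∈ Ioo (0 : ℝ) 1 ∨ 1 ≤ t := by
  rcases le_or_gt t 0 with h | h
  · exact Or.inl h
  · rcases lt_or_ge t 1 with h' | h'
    · exact Or.inr (Or.inl ⟨h, h'⟩)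
    · exact Or.inr (Or.inr h')

theorem edgePt_eq_inner_iff {e e' : G.edgeSet} {s : ℝ} {t : Ioo (0 : ℝ) 1} :
    edgePt e s = inner e' t ↔ e = e' ∧ s = t := by
  rcases edgePt_trichotomy s with h | h | h
  · rw [edgePt_of_nonpos e h]
    simp only [reduceCtorEq, false_iff, not_and]
    rintro - rfl
    exact absurd t.2.1 (not_lt.2 h)
  · rw [edgePt_of_mem e h]
    simp only [inner.injEq, Subtype.ext_iff]
  · rw [edgePt_of_one_le e h]
    simp only [reduceCtorEq, false_iff, not_and]
    rintro - rfl
    exact absurd t.2.2 (not_lt.2 h)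

theorem edgePt_eq_edgePt_iff {e e' : G.edgeSet} {s t : ℝ} (ht : t ∈ Ioo (0 : ℝ) 1) :
    edgePt e s = edgePt e' t ↔ e = e' ∧ s = t := by
  rw [edgePt_of_mem e' ht, edgePt_eq_inner_iff]

theorem injOn_edgePt (e : G.edgeSet) : InjOn (edgePt e) (Icc 0 1) := by
  intro s hs t ht h
  rcases eq_or_lt_of_le ht.1 with h0 | h0
  · subst h0
    rcases eq_or_lt_of_le hs.1 with h1 | h1
    · exact h1.symm
    rcases eq_or_lt_of_le hs.2 with h2 | h2
    · rw [edgePt_of_one_le e h2.ge, edgePt_of_nonpos e le_rfl] at h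
      exact absurd (vertex.inj h).symm (adj_edge e).ne
    · exact ((edgePt_eq_edgePt_iff ⟨h1, h2⟩).1 h.symm).2.symm
  rcases eq_or_lt_of_le ht.2 with h0' | h0'
  · subst h0'
    rcases eq_or_lt_of_le hs.1 with h1 | h1
    · rw [edgePt_of_one_le e le_rfl, edgePt_of_nonpos e h1.ge] at h
      exact absurd (vertex.inj h) (adj_edge e).ne
    rcases eq_or_lt_of_le hs.2 with h2 | h2
    · exact h2
    · exact ((edgePt_eq_edgePt_iff ⟨h1, h2⟩).1 h.symm).2.symm
  · exact ((edgePt_eq_edgePt_iff ⟨h0, h0'⟩).1 h).2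

theorem edgePt_mem_complexPts (e : G.edgeSet) (t : ℝ) : edgePt e t ∈ complexPts G := by
  rintro ⟨ω, h⟩
  rcases edgePt_trichotomy t with h' | h' | h'
  · rw [edgePt_of_nonpos e h'] at h; cases h
  · rw [edgePt_of_mem e h'] at h; cases h
  · rw [edgePt_of_one_le e h'] at h; cases h

/-! ### Points of the basic neighbourhoods of ends, and continuity of the edges. -/

theorem vertex_mem_basicNhd_iff {S : Finset V} {ω : GraphEnd G} {z : G.edgeSet → Ioo (0 : ℝ) 1}
    {v : V} : vertex v ∈ basicNhd S ω z ↔ v ∈ endComp S ω := by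
  constructor
  · rintro (((⟨w, hw, h⟩ | ⟨_, _, _, _, h⟩) | ⟨_, _, h⟩) | ⟨e, t, ht, h, h'⟩)
    · cases h; exact hw
    · cases h
    · cases h
    · rcases edgePt_trichotomy t with h1 | h1 | h1
      · rw [edgePt_of_nonpos e h1] at h
        cases h
        rcases h' with h' | h'
        · exact absurd ((z e).2.1.trans h'.2.2) (not_lt.2 h1)
        · exact h'.2.1
      · rw [edgePt_of_mem e h1] at h; cases h
      · rw [edgePt_of_one_le e h1] at h
        cases h
        rcases h' with h' | h'
        · exact h'.2.1
        · exact absurd (h'.2.2.trans (z e).2.2) (not_lt.2 h1)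
  · exact fun h => Or.inl (Or.inl (Or.inl ⟨v, h, rfl⟩))

theorem inner_mem_basicNhd_iff {S : Finset V} {ω : GraphEnd G} {z : G.edgeSet → Ioo (0 : ℝ) 1}
    {e : G.edgeSet} {t : Ioo (0 : ℝ) 1} : inner e t ∈ basicNhd S ω z ↔
      (edgeTail e ∈ endComp S ω ∧ edgeHead e ∈ endComp S ω) ∨
      (edgeTail e ∈ S ∧ edgeHead e ∈ endComp S ω ∧ (z e : ℝ) < t) ∨
      (edgeHead e ∈ S ∧ edgeTail e ∈ endComp S ω ∧ (t : ℝ) < z e) := by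
  constructor
  · rintro (((⟨w, hw, h⟩ | ⟨e', t', h1, h2, h⟩) | ⟨_, _, h⟩) | ⟨e', t', ht, h, h'⟩)
    · cases h
    · cases h; exact Or.inl ⟨h1, h2⟩
    · cases h
    · obtain ⟨rfl, rfl⟩ := edgePt_eq_inner_iff.1 h.symm
      exact Or.inr h'
  · rintro (h | h)
    · exact Or.inl (Or.inl (Or.inr ⟨e, t, h.1, h.2, rfl⟩))
    · exact Or.inr ⟨e, t, ⟨t.2.1.le, t.2.2.le⟩, (edgePt_of_mem e t.2).symm, h⟩

theorem ofEnd_mem_basicNhd_iff {S : Finset V} {ω ω' : GraphEnd G}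
    {z : G.edgeSet → Ioo (0 : ℝ) 1} : ofEnd ω' ∈ basicNhd S ω z ↔ ω' ∈ endsInComp S ω := by
  constructor
  · rintro (((⟨w, hw, h⟩ | ⟨_, _, _, _, h⟩) | ⟨_, h', h⟩) | ⟨e, t, ht, h, h'⟩)
    · cases h
    · cases h
    · cases h; exact h'
    · exact absurd ⟨ω', h⟩ (edgePt_mem_complexPts e t)
  · exact fun h => Or.inl (Or.inr ⟨ω', h, rfl⟩)

theorem isOpen_basicNhd (S : Finset V) (ω : GraphEnd G) (z : G.edgeSet → Ioo (0 : ℝ) 1) :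
    IsOpen (basicNhd S ω z) :=
  TopologicalSpace.isOpen_generateFrom_of_mem (Or.inr ⟨S, ω, z, rfl⟩)

theorem IsComplexOpen.isOpen {U : Set (EndSpace G)} (h : IsComplexOpen U) : IsOpen U :=
  TopologicalSpace.isOpen_generateFrom_of_mem (Or.inl h)

/-- The description of the inner points in a basic neighbourhood stays correct at the endvertices: a
neighbour of `C(S, ω)` lies in `S` or in `C(S, ω)`, and `0 < z e < 1` settles the inequalities.
Openness can then be read off. -/
theorem isOpen_edgePt_preimage_basicNhd (e : G.edgeSet) (S : Finset V) (ω : GraphEnd G)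
    (z : G.edgeSet → Ioo (0 : ℝ) 1) :
    IsOpen {t : unitInterval | edgePt e (t : ℝ) ∈ basicNhd S ω z} := by
  have hz := (z e).2
  have key : ∀ t : ℝ, edgePt e t ∈ basicNhd S ω z ↔
      (edgeTail e ∈ endComp S ω ∧ edgeHead e ∈ endComp S ω) ∨
      (edgeTail e ∈ S ∧ edgeHead e ∈ endComp S ω ∧ (z e : ℝ) < t) ∨
      (edgeHead e ∈ S ∧ edgeTail e ∈ endComp S ω ∧ (t : ℝ) < z e) := by
    intro t
    have hT : edgeTail e ∈ endComp S ω → edgeTail e ∉ S := notMem_of_mem_endComp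
    have hH : edgeHead e ∈ endComp S ω → edgeHead e ∉ S := notMem_of_mem_endComp
    rcases edgePt_trichotomy t with h1 | h1 | h1
    · have h2 : (t : ℝ) < z e := h1.trans_lt hz.1
      rw [edgePt_of_nonpos e h1, vertex_mem_basicNhd_iff]
      have h3 : edgeTail e ∈ endComp S ω → edgeHead e ∉ S → edgeHead e ∈ endComp S ω :=
        fun h h' => mem_endComp_of_adj h h' (adj_edge e)
      have h4 := not_lt.2 h2.le
      tauto
    · rw [edgePt_of_mem e h1, inner_mem_basicNhd_iff]
    · have h2 : (z e : ℝ) < t := hz.2.trans_le h1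
      rw [edgePt_of_one_le e h1, vertex_mem_basicNhd_iff]
      have h3 : edgeHead e ∈ endComp S ω → edgeTail e ∉ S → edgeTail e ∈ endComp S ω :=
        fun h h' => mem_endComp_of_adj h h' (adj_edge e).symm
      have h4 := not_lt.2 h2.le
      tauto
  simp only [key, ofPred_or, ofPred_and]
  refine (isOpen_const.inter isOpen_const).union ((isOpen_const.inter (isOpen_const.inter
    ?_)).union (isOpen_const.inter (isOpen_const.inter ?_)))
  · exact isOpen_lt continuous_const continuous_subtype_val
  · exact isOpen_lt continuous_subtype_val continuous_const

theorem continuous_edgePt (e : G.edgeSet) : Continuous (edgePt e) := by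
  have h : Continuous fun t : unitInterval => edgePt e (t : ℝ) := by
    refine continuous_generateFrom_iff.2 ?_
    rintro U (hU | ⟨S, ω, z, rfl⟩)
    · exact hU.2 e
    · exact isOpen_edgePt_preimage_basicNhd e S ω z
  convert h.comp (continuous_projIcc (h := zero_le_one' ℝ)) using 1
  funext t
  simp only [Function.comp_apply]
  rcases edgePt_trichotomy t with h1 | h1 | h1
  · rw [projIcc_of_le_left _ h1, edgePt_of_nonpos e h1, edgePt_of_nonpos e le_rfl]
  · rw [projIcc_of_mem _ (Ioo_subset_Icc_self h1)]
  · rw [projIcc_of_right_le _ h1, edgePt_of_one_le e h1, edgePt_of_one_le e le_rfl]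

theorem isOpen_edgePt_image_Ioo (e : G.edgeSet) {a b : ℝ} (ha : 0 ≤ a) (hb : b ≤ 1) :
    IsOpen (edgePt e '' Ioo a b) := by
  refine IsComplexOpen.isOpen ⟨?_, fun e' => ?_⟩
  · rintro _ ⟨t, -, rfl⟩
    exact edgePt_mem_complexPts e t
  · have : {t : unitInterval | edgePt e' (t : ℝ) ∈ edgePt e '' Ioo a b} =
        {t : unitInterval | e = e' ∧ (t : ℝ) ∈ Ioo a b} := by
      ext t
      constructor
      · rintro ⟨s, hs, h⟩
        obtain ⟨rfl, h2⟩ := (edgePt_eq_edgePt_iff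
          (⟨ha.trans_lt hs.1, hs.2.trans_le hb⟩ : s ∈ Ioo (0 : ℝ) 1)).1 h.symm
        exact ⟨rfl, h2 ▸ hs⟩
      · rintro ⟨rfl, h⟩
        exact ⟨t, h, rfl⟩
    rw [this, ofPred_and]
    exact isOpen_const.inter (isOpen_Ioo.preimage continuous_subtype_val)

end EndSpace

end GraphEnds

namespace GraphEnds

universe u

variable {V : Type u} {G : SimpleGraph V}

namespace EndSpace

/-! ### Connectedness -/

/-- The connected component of `G` to which a point of `|G|` belongs. -/
noncomputable def component : EndSpace G → G.ConnectedComponent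
  | vertex v => G.connectedComponentMk v
  | inner e _ => G.connectedComponentMk (edgeTail e)
  | ofEnd ω => G.connectedComponentMk ((Quotient.out ω).vert 0)

theorem component_edgePt (e : G.edgeSet) (t : ℝ) :
    component (edgePt e t) = G.connectedComponentMk (edgeTail e) := by
  rcases edgePt_trichotomy t with h1 | h1 | h1
  · rw [edgePt_of_nonpos e h1, component]
  · rw [edgePt_of_mem e h1, component]
  · rw [edgePt_of_one_le e h1, component]
    exact SimpleGraph.ConnectedComponent.sound (adj_edge e).symm.reachable

theorem _root_.GraphEnds.Ray.reachable (R : Ray G) (n : ℕ) :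
    G.Reachable (R.vert 0) (R.vert n) := by
  induction n with
  | zero => rfl
  | succ n ih => exact ih.trans (R.adj n).reachable

/-- Shows that the representative ray chosen in `component` is immaterial. -/
theorem component_ofEnd {ω : GraphEnd G} {S : Finset V} {v : V} (hv : v ∈ endComp S ω) :
    component (ofEnd ω) = G.connectedComponentMk v := by
  rw [component]
  refine SimpleGraph.ConnectedComponent.sound ?_
  obtain ⟨n, hn⟩ := ((Quotient.out ω).eventually_mem_endComp S).exists
  have h : (Quotient.out ω).toEnd = ω := Quotient.out_eq ω
  rw [h] at hn
  exact (Ray.reachable _ n).trans (reachable_of_mem_endComp hn hv)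

theorem component_of_mem_basicNhd {S : Finset V} {ω : GraphEnd G}
    {z : G.edgeSet → Ioo (0 : ℝ) 1} {q : EndSpace G} (hq : q ∈ basicNhd S ω z) :
    component q = component (ofEnd ω) := by
  have hadj : ∀ e : G.edgeSet, G.connectedComponentMk (edgeHead e) =
      G.connectedComponentMk (edgeTail e) := fun e =>
    SimpleGraph.ConnectedComponent.sound (adj_edge e).symm.reachable
  cases q with
  | vertex v => rw [component_ofEnd (vertex_mem_basicNhd_iff.1 hq), component]
  | inner e t =>
    rcases inner_mem_basicNhd_iff.1 hq with h | h | h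
    · rw [component_ofEnd h.1, component]
    · rw [component_ofEnd h.2.1, component, hadj]
    · rw [component_ofEnd h.2.1, component]
  | ofEnd ω' =>
    obtain ⟨R, rfl, hR⟩ := ofEnd_mem_basicNhd_iff.1 hq
    obtain ⟨n, hn⟩ := (R.eventually_mem_endComp S).exists
    rw [component_ofEnd hn, component_ofEnd (hR n)]

theorem isLocallyConstant_component : IsLocallyConstant (component (G := G)) := by
  refine (IsLocallyConstant.iff_exists_open _).2 fun q => ?_
  by_cases hq : q ∈ complexPts G
  · refine ⟨{p | p ∈ complexPts G ∧ component p = component q}, IsComplexOpen.isOpen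
      ⟨fun p hp => hp.1, fun e => ?_⟩, ⟨hq, rfl⟩, fun p hp => hp.2⟩
    have : {t : unitInterval | edgePt e (t : ℝ) ∈
        {p | p ∈ complexPts G ∧ component p = component q}} =
        {_t : unitInterval | G.connectedComponentMk (edgeTail e) = component q} := by
      ext t
      simp [edgePt_mem_complexPts, component_edgePt]
    rw [this]
    exact isOpen_const
  -- With `S = ∅` there are no half-edges, so the choice of `z` plays no role.
  · obtain ⟨ω, rfl⟩ : q ∈ range ofEnd := not_not.1 hq
    exact ⟨basicNhd ∅ ω fun _ => ⟨1 / 2, by norm_num, by norm_num⟩, isOpen_basicNhd _ _ _,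
      ofEnd_mem_basicNhd_iff.2 (mem_endsInComp_self _ _), fun p hp => component_of_mem_basicNhd hp⟩

theorem connected_of_preconnectedSpace [PreconnectedSpace (EndSpace G)] [Nonempty V] :
    G.Connected where
  preconnected u v := by
    have := isLocallyConstant_component (G := G).apply_eq_of_preconnectedSpace
      (vertex u) (vertex v)
    exact SimpleGraph.ConnectedComponent.exact this

end EndSpace

/-! ### Breadth-first search -/

theorem exists_adj_dist_succ (hc : G.Connected) (r : V) {v : V} {n : ℕ}
    (h : G.dist r v = n + 1) : ∃ u, G.Adj u v ∧ G.dist r u = n := by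
  obtain ⟨p, hp⟩ := hc.exists_walk_length_eq_dist v r
  rw [SimpleGraph.dist_comm, h] at hp
  cases p with
  | nil => simp at hp
  | cons hadj q =>
    rename_i u
    refine ⟨u, hadj.symm, ?_⟩
    have h1 : q.length = n := by simpa using hp
    have h2 := SimpleGraph.dist_le q
    rw [SimpleGraph.dist_comm] at h2
    have h3 := hc.dist_triangle (u := r) (v := u) (w := v)
    rw [SimpleGraph.dist_eq_one_iff_adj.2 hadj.symm] at h3
    omega

theorem finite_setOf_dist_le (hc : G.Connected) (hG : ∀ v, (G.neighborSet v).Finite) (r : V)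
    (n : ℕ) : {v | G.dist r v ≤ n}.Finite := by
  induction n with
  | zero =>
    refine (finite_singleton r).subset fun v hv => ?_
    have : G.dist r v = 0 := Nat.le_zero.1 hv
    exact (hc.dist_eq_zero_iff.1 this).symm
  | succ n ih =>
    refine (ih.union (ih.biUnion fun v _ => hG v)).subset fun v hv => ?_
    rcases Nat.lt_or_ge (G.dist r v) (n + 1) with h | h
    · exact Or.inl (Nat.lt_succ_iff.1 h)
    · obtain ⟨u, hu, hu'⟩ := exists_adj_dist_succ hc r (le_antisymm hv h)
      exact Or.inr (mem_biUnion (show u ∈ {v | G.dist r v ≤ n} from hu'.le) hu)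

open Classical in
/-- The predecessor of `v` on a shortest path from the root `r`. -/
noncomputable def bfsParent (G : SimpleGraph V) (r v : V) : V :=
  if h : ∃ u, G.Adj u v ∧ G.dist r u + 1 = G.dist r v then h.choose else v

theorem bfsParent_spec (hc : G.Connected) (r : V) {v : V} {n : ℕ} (h : G.dist r v = n + 1) :
    G.Adj (bfsParent G r v) v ∧ G.dist r (bfsParent G r v) = n := by
  have h' : ∃ u, G.Adj u v ∧ G.dist r u + 1 = G.dist r v := by
    obtain ⟨u, h1, h2⟩ := exists_adj_dist_succ hc r h
    exact ⟨u, h1, by omega⟩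
  rw [bfsParent, dif_pos h']
  exact ⟨h'.choose_spec.1, by have := h'.choose_spec.2; omega⟩

/-- The vertex at distance `n` from the root on the breadth-first search path from `r` to `v`. -/
noncomputable def bfsAncestor (G : SimpleGraph V) (r v : V) (n : ℕ) : V :=
  (bfsParent G r)^[G.dist r v - n] v

theorem bfsAncestor_self (r v : V) : bfsAncestor G r v (G.dist r v) = v := by
  simp [bfsAncestor]

theorem bfsAncestor_of_dist_eq (hc : G.Connected) (r : V) {v : V} {k n : ℕ}
    (h : G.dist r v = k + 1) (hn : n ≤ k) :
    bfsAncestor G r v n = bfsAncestor G r (bfsParent G r v) n := by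
  rw [bfsAncestor, bfsAncestor, (bfsParent_spec hc r h).2, h,
    show k + 1 - n = (k - n) + 1 by omega, Function.iterate_succ_apply]

theorem dist_bfsAncestor (hc : G.Connected) (r : V) {v : V} {n : ℕ} (hn : n ≤ G.dist r v) :
    G.dist r (bfsAncestor G r v n) = n := by
  obtain ⟨k, hk⟩ : ∃ k, G.dist r v = n + k := ⟨_, (Nat.add_sub_of_le hn).symm⟩
  induction k generalizing v with
  | zero => rw [← show G.dist r v = n from hk, bfsAncestor_self]
  | succ k ih =>
    rw [bfsAncestor_of_dist_eq hc r (k := n + k) hk (by omega)]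
    have := (bfsParent_spec hc r (n := n + k) hk).2
    exact ih (by omega) this

theorem bfsAncestor_adj (hc : G.Connected) (r : V) {v : V} {n : ℕ} (hn : n + 1 ≤ G.dist r v) :
    G.Adj (bfsAncestor G r v n) (bfsAncestor G r v (n + 1)) := by
  obtain ⟨k, hk⟩ : ∃ k, G.dist r v = n + 1 + k := ⟨_, (Nat.add_sub_of_le hn).symm⟩
  induction k generalizing v with
  | zero =>
    have h1 : G.dist r v = n + 1 := hk
    have h2 := bfsParent_spec hc r h1
    rw [bfsAncestor_of_dist_eq hc r h1 le_rfl, ← h1, bfsAncestor_self]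
    have h3 := bfsAncestor_self (G := G) r (bfsParent G r v)
    rw [h2.2] at h3
    rw [h3]
    exact h2.1
  | succ k ih =>
    have h1 : G.dist r v = (n + 1 + k) + 1 := hk
    rw [bfsAncestor_of_dist_eq hc r h1 (by omega), bfsAncestor_of_dist_eq hc r h1 (by omega)]
    have := (bfsParent_spec hc r h1).2
    exact ih (by omega) this

/-- A set of vertices that is closed under adjacency outside a ball contains, with each vertex
outside the ball, its descendants. -/
theorem mem_of_bfsAncestor_mem (hc : G.Connected) (r : V) {D : Set V} {n : ℕ}
    (hD : ∀ u v, u ∈ D → G.Adj u v → n ≤ G.dist r v → v ∈ D) {v : V} (hn : n ≤ G.dist r v)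
    (h : bfsAncestor G r v n ∈ D) : v ∈ D := by
  obtain ⟨k, hk⟩ : ∃ k, G.dist r v = n + k := ⟨_, (Nat.add_sub_of_le hn).symm⟩
  induction k generalizing v with
  | zero => rwa [← show G.dist r v = n from hk, bfsAncestor_self] at h
  | succ k ih =>
    rw [bfsAncestor_of_dist_eq hc r (k := n + k) hk (by omega)] at h
    have := bfsParent_spec hc r (n := n + k) hk
    exact hD _ _ (ih (by omega) h this.2) this.1 hn

/-- An ultrafilter on a family of longer and longer shortest paths from `r` selects a ray. -/
theorem exists_ray_of_ultrafilter (hc : G.Connected) (hG : ∀ v, (G.neighborSet v).Finite) (r : V)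
    {α : Type*} (F : Ultrafilter α) (g : α → ℕ → V)
    (hg : ∀ n, ∀ᶠ a in (F : Filter α), G.dist r (g a n) = n)
    (hg' : ∀ n, ∀ᶠ a in (F : Filter α), G.Adj (g a n) (g a (n + 1))) :
    ∃ R : Ray G, (∀ n, G.dist r (R.vert n) = n) ∧
      ∀ n, ∀ᶠ a in (F : Filter α), g a n = R.vert n := by
  -- König's lemma: the ball of radius `n` is finite, so the ultrafilter concentrates the `n`-th
  -- vertices on a single vertex.
  have h1 : ∀ n, ∃ w, ∀ᶠ a in (F : Filter α), g a n = w := by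
    intro n
    have hfin := finite_setOf_dist_le hc hG r n
    have h2 : ⋃ w ∈ {v | G.dist r v ≤ n}, {a | g a n = w} ∈ F := by
      filter_upwards [hg n] with a ha
      exact mem_biUnion (show g a n ∈ {v | G.dist r v ≤ n} from ha.le) rfl
    obtain ⟨w, -, hw⟩ := (Ultrafilter.finite_biUnion_mem_iff hfin).1 h2
    exact ⟨w, hw⟩
  choose w hw using h1
  have hdist : ∀ n, G.dist r (w n) = n := fun n => by
    obtain ⟨a, h1, h2⟩ := ((hw n).and (hg n)).exists
    rwa [h1] at h2
  refine ⟨⟨w, fun a b h => ?_, fun n => ?_⟩, hdist, hw⟩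
  · rw [← hdist a, ← hdist b, h]
  · obtain ⟨a, h1, h2, h3⟩ := ((hw n).and ((hw (n + 1)).and (hg' n))).exists
    rwa [h1, h2] at h3

theorem exists_forall_dist_lt (r : V) (S : Finset V) : ∃ N, ∀ v ∈ S, G.dist r v < N := by
  obtain ⟨N, hN⟩ := (S.image (G.dist r)).bddAbove
  exact ⟨N + 1, fun v hv => Nat.lt_succ_iff.2 (hN (by simpa using ⟨v, hv, rfl⟩))⟩

/-- Every end contains a ray all of whose initial segments are shortest paths from `r`. -/
theorem exists_geodesic_ray (hc : G.Connected) (hG : ∀ v, (G.neighborSet v).Finite) (r : V)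
    (ω : GraphEnd G) : ∃ R : Ray G, R.toEnd = ω ∧ ∀ n, G.dist r (R.vert n) = n := by
  obtain ⟨L, rfl⟩ := Quotient.exists_rep ω
  -- The vertices of `L` are distinct and balls are finite, so `L` leaves every ball. The search
  -- paths to its vertices therefore get arbitrarily long and select a ray `R`.
  have hL : ∀ n, ∀ᶠ k in (hyperfilter ℕ : Filter ℕ), n ≤ G.dist r (L.vert k) := by
    intro n
    refine hyperfilter_le_cofinite ?_
    refine ((finite_setOf_dist_le hc hG r n).preimage L.injective.injOn).subset fun k hk => ?_
    exact (not_le.1 (show ¬ n ≤ G.dist r (L.vert k) from hk)).le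
  obtain ⟨R, hR, hRL⟩ := exists_ray_of_ultrafilter hc hG r (hyperfilter ℕ)
    (fun k => bfsAncestor G r (L.vert k))
    (fun n => (hL n).mono fun k hk => dist_bfsAncestor hc r hk)
    (fun n => (hL (n + 1)).mono fun k hk => bfsAncestor_adj hc r hk)
  refine ⟨R, Ray.toEnd_eq_iff.2 fun S => ?_, hR⟩
  obtain ⟨N, hN⟩ := exists_forall_dist_lt (G := G) r S
  obtain ⟨C, hC⟩ := R.exists_hasTailIn S
  obtain ⟨D, hD⟩ := L.exists_hasTailIn S
  have hout : ∀ v, N ≤ G.dist r v → v ∉ (S : Set V) := fun v hv hvS =>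
    absurd (hN v (by simpa using hvS)) (not_lt.2 hv)
  have hRN : R.vert N ∈ C := R.mem_of_hasTailIn hC (N := N)
    (fun n hn => hout _ (by rw [hR]; exact hn)) le_rfl
  have hD' : ∀ᶠ k in (hyperfilter ℕ : Filter ℕ), L.vert k ∈ D :=
    (hyperfilter_le_cofinite.trans Nat.cofinite_eq_atTop.le) hD
  obtain ⟨k, h1, h2, h3⟩ := ((hRL N).and ((hL N).and hD')).exists
  -- The search path to `L.vert k` passes through `R.vert N` and stays outside the ball containing
  -- `S` from there on, so it links the two rays in `G - S`.
  have : L.vert k ∈ C := mem_of_bfsAncestor_mem hc r (D := {v | v ∈ C})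
    (fun u v hu huv hv => SimpleGraph.ComponentCompl.mem_of_adj _ _ hu (hout v hv) huv) h2
    (by rw [h1]; exact hRN)
  exact ⟨C, hC, componentCompl_eq_of_mem this h3 ▸ hD⟩

namespace EndSpace

/-! ### Compactness -/

theorem finite_setOf_edge (A : Set V) (hA : A.Finite) :
    {e : G.edgeSet | edgeTail e ∈ A ∧ edgeHead e ∈ A}.Finite := by
  refine Set.Finite.of_finite_image (f := fun e : G.edgeSet => (edgeTail e, edgeHead e))
    ((hA.prod hA).subset ?_) ?_
  · rintro _ ⟨e, he, rfl⟩
    exact he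
  · intro e _ e' _ h
    exact edge_ext (congrArg Prod.fst h) (congrArg Prod.snd h)

/-- The points of `|G|` that do not lie near the ball of radius `n` around `r`. -/
def farPts (r : V) (n : ℕ) : Set (EndSpace G) :=
  {q | match q with
    | vertex v => n ≤ G.dist r v
    | inner e _ => n ≤ G.dist r (edgeTail e) ∧ n ≤ G.dist r (edgeHead e)
    | ofEnd _ => True}

/-- A point that is not far is a vertex near `r` or lies on an edge with an endvertex near `r`. Only
finitely many vertices and edges are involved, each compact. -/
theorem exists_isCompact_compl_farPts_subset (hc : G.Connected)
    (hG : ∀ v, (G.neighborSet v).Finite) (r : V) (n : ℕ) :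
    ∃ K : Set (EndSpace G), IsCompact K ∧ (farPts r n)ᶜ ⊆ K := by
  have hA := finite_setOf_dist_le hc hG r (n + 1)
  refine ⟨vertex '' {v | G.dist r v ≤ n + 1} ∪
    ⋃ e ∈ {e : G.edgeSet | edgeTail e ∈ {v | G.dist r v ≤ n + 1} ∧
      edgeHead e ∈ {v | G.dist r v ≤ n + 1}}, edgePt e '' Icc 0 1,
    (hA.image _).isCompact.union ((finite_setOf_edge _ hA).isCompact_biUnion fun e _ =>
      isCompact_Icc.image (continuous_edgePt e)), fun q hq => ?_⟩
  cases q with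
  | vertex v =>
    refine Or.inl ⟨v, ?_, rfl⟩
    have : ¬ n ≤ G.dist r v := hq
    simp only [mem_ofPred_eq]
    omega
  | inner e t =>
    have h1 : ¬ (n ≤ G.dist r (edgeTail e) ∧ n ≤ G.dist r (edgeHead e)) := hq
    have h2 := (adj_edge e).diff_dist_adj (u := r)
    refine Or.inr (mem_biUnion (x := e) ?_ ⟨t, ⟨t.2.1.le, t.2.2.le⟩, edgePt_of_mem e t.2⟩)
    simp only [mem_ofPred_eq]
    omega
  | ofEnd ω => exact absurd trivial hq

/-- An ultrafilter either lives on a compact set near the root, or escapes every ball. In the second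
case the shortest paths and rays leading to its points select a ray, and the ultrafilter converges
to the end of that ray. -/
theorem compactSpace (hc : G.Connected) (hG : ∀ v, (G.neighborSet v).Finite) :
    CompactSpace (EndSpace G) := by
  obtain ⟨r⟩ := hc.nonempty
  refine ⟨isCompact_iff_ultrafilter_le_nhds.2 fun F _ => ?_⟩
  by_cases hF : ∀ n, farPts r n ∈ F
  swap
  · push Not at hF
    obtain ⟨n, hn⟩ := hF
    obtain ⟨K, hK, hK'⟩ := exists_isCompact_compl_farPts_subset hc hG r n
    obtain ⟨q, -, hq⟩ := isCompact_iff_ultrafilter_le_nhds.1 hK F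
      (le_principal_iff.2 (mem_of_superset (Ultrafilter.compl_mem_iff_notMem.2 hn) hK'))
    exact ⟨q, mem_univ q, hq⟩
  choose γ hγ hγ' using exists_geodesic_ray hc hG r
  let g : EndSpace G → ℕ → V := fun q => match q with
    | vertex v => bfsAncestor G r v
    | inner e _ => bfsAncestor G r (edgeTail e)
    | ofEnd ω => (γ ω).vert
  obtain ⟨R, hR, hgR⟩ := exists_ray_of_ultrafilter hc hG r F g
    (fun n => by
      filter_upwards [hF n] with q hq
      cases q with
      | vertex v => exact dist_bfsAncestor hc r hq
      | inner e t => exact dist_bfsAncestor hc r hq.1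
      | ofEnd ω => exact hγ' ω n)
    (fun n => by
      filter_upwards [hF (n + 1)] with q hq
      cases q with
      | vertex v => exact bfsAncestor_adj hc r hq
      | inner e t => exact bfsAncestor_adj hc r hq.1
      | ofEnd ω => exact (γ ω).adj n)
  refine ⟨ofEnd R.toEnd, mem_univ _, ?_⟩
  rw [TopologicalSpace.nhds_generateFrom]
  refine le_iInf₂ ?_
  rintro U ⟨hU, hU' | ⟨S, ω, z, rfl⟩⟩
  · exact absurd ⟨_, rfl⟩ (hU'.1 hU)
  rw [le_principal_iff]
  obtain ⟨N, hN⟩ := exists_forall_dist_lt (G := G) r S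
  have hout : ∀ v, N ≤ G.dist r v → v ∉ S := fun v hv hvS =>
    absurd (hN v hvS) (not_lt.2 hv)
  have hRS : R.vert N ∈ endComp S ω :=
    R.mem_endComp_of_toEnd_mem (ofEnd_mem_basicNhd_iff.1 hU) (N := N)
      (fun n hn => hout _ (by rw [hR]; exact hn)) le_rfl
  have hD : ∀ u v, u ∈ endComp S ω → G.Adj u v → N ≤ G.dist r v → v ∈ endComp S ω :=
    fun u v hu huv hv => mem_endComp_of_adj hu (hout v hv) huv
  -- The path towards `q` passes through `R.vert N`, which lies in `C(S, ω)`; beyond level `N` it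
  -- avoids `S` and so cannot leave that component.
  filter_upwards [hF N, hgR N] with q hq hq'
  cases q with
  | vertex v =>
    exact vertex_mem_basicNhd_iff.2 (mem_of_bfsAncestor_mem hc r hD hq
      (by rw [show bfsAncestor G r v N = R.vert N from hq']; exact hRS))
  | inner e t =>
    have h := mem_of_bfsAncestor_mem hc r hD hq.1
      (by rw [show bfsAncestor G r (edgeTail e) N = R.vert N from hq']; exact hRS)
    exact inner_mem_basicNhd_iff.2 (Or.inl ⟨h, hD _ _ h (adj_edge e) hq.2⟩)
  | ofEnd ω' =>
    rw [ofEnd_mem_basicNhd_iff, ← hγ ω']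
    refine toEnd_mem_endsInComp (N := N) fun n hn => ?_
    induction n, hn using Nat.le_induction with
    | base =>
      have : (γ ω').vert N = R.vert N := hq'
      rw [this]
      exact hRS
    | succ n hn ih => exact hD _ _ ih ((γ ω').adj n) (by rw [hγ']; omega)

end EndSpace

end GraphEnds

/-! ### Geodesics in compact metric spaces -/

namespace GraphEnds

section Geodesic

variable {X : Type*} [MetricSpace X]

/-- A point of the compact sphere of radius `s` about `p` that is nearest to `q` does at least as
well as every approximate solution. -/
theorem exists_between_of_approx [CompactSpace X] {p q : X} {s : ℝ}
    (h : ∀ ε, 0 < ε → ∃ z, dist p z = s ∧ dist z q ≤ dist p q - s + ε) :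
    ∃ z, dist p z = s ∧ dist z q = dist p q - s := by
  have hK : IsCompact {z : X | dist p z = s} :=
    (isClosed_eq (continuous_const.dist continuous_id) continuous_const).isCompact
  obtain ⟨z₀, hz₀, -⟩ := h 1 one_pos
  obtain ⟨z, hz, hmin⟩ := hK.exists_isMinOn ⟨z₀, hz₀⟩
    (f := fun z => dist z q) (continuous_id.dist continuous_const).continuousOn
  refine ⟨z, hz, le_antisymm (le_of_forall_pos_le_add fun ε hε => ?_) ?_⟩
  · obtain ⟨w, hw, hw'⟩ := h ε hε
    exact (isMinOn_iff.1 hmin w hw).trans hw'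
  · have := dist_triangle p z q
    rw [show dist p z = s from hz] at this
    linarith

variable (X) in
/-- `X` is metrically convex: between two points there is a third at any prescribed distances
that add up to the distance of the two. -/
def HasBetween : Prop :=
  ∀ (p q : X) (s : ℝ), 0 ≤ s → s ≤ dist p q → ∃ z, dist p z = s ∧ dist z q = dist p q - s

/-- Parameters are added one at a time. The image of a new `u` is chosen between those of its
neighbours `a < u < b`; all its other distances are then forced. -/
theorem exists_geodesic_on_finset (h : HasBetween X) (x y : X) (F : Finset unitInterval) :
    ∃ f : unitInterval → X, f 0 = x ∧ f 1 = y ∧ ∀ s ∈ insert 0 (insert 1 F),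
      ∀ t ∈ insert 0 (insert 1 F), s ≤ t →
        dist (f s) (f t) = dist x y * ((t : ℝ) - s) := by
  induction F using Finset.induction_on with
  | empty =>
    classical
    refine ⟨fun s => if s = 0 then x else y, by simp, by simp, ?_⟩
    simp
  | insert u F _ ih =>
    obtain ⟨f, h0, h1, hf⟩ := ih
    set F' : Finset unitInterval := insert 0 (insert 1 F) with hF'
    have hins : insert 0 (insert 1 (insert u F)) = insert u F' := by
      rw [hF', Finset.insert_comm 1 u, Finset.insert_comm 0 u]
    rw [hins]
    by_cases hu : u ∈ F'
    · rw [Finset.insert_eq_of_mem hu]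
      exact ⟨f, h0, h1, hf⟩
    have m0 : (0 : unitInterval) ∈ F' := by simp [hF']
    have m1 : (1 : unitInterval) ∈ F' := by simp [hF']
    have u0 : 0 ≠ u := fun h => hu (h ▸ m0)
    have u1 : 1 ≠ u := fun h => hu (h ▸ m1)
    have hu0 : 0 < u := lt_of_le_of_ne unitInterval.nonneg' u0
    have hu1 : u < 1 := lt_of_le_of_ne unitInterval.le_one' u1.symm
    obtain ⟨a, ha, hamax⟩ := (F'.filter (· < u)).exists_maximal
      ⟨0, Finset.mem_filter.2 ⟨m0, hu0⟩⟩
    obtain ⟨b, hb, hbmin⟩ := (F'.filter (u < ·)).exists_minimal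
      ⟨1, Finset.mem_filter.2 ⟨m1, hu1⟩⟩
    rw [Finset.mem_filter] at ha hb
    have hle : ∀ s ∈ F', s ≤ u → s ≤ a := fun s hs hsu => by
      rcases le_total s a with h | h
      · exact h
      · exact hamax (Finset.mem_filter.2 ⟨hs, lt_of_le_of_ne hsu fun h => hu (h ▸ hs)⟩) h
    have hge : ∀ s ∈ F', u ≤ s → b ≤ s := fun s hs hsu => by
      rcases le_total b s with h | h
      · exact h
      · exact hbmin (Finset.mem_filter.2 ⟨hs, lt_of_le_of_ne hsu fun h => hu (h ▸ hs)⟩) h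
    have hau : (a : ℝ) ≤ u := ha.2.le
    have hub : (u : ℝ) ≤ b := hb.2.le
    have hL : 0 ≤ dist x y := dist_nonneg
    have hab := hf a ha.1 b hb.1 (ha.2.le.trans hb.2.le)
    obtain ⟨z, hz1, hz2⟩ := h (f a) (f b) (dist x y * (u - a))
      (mul_nonneg hL (sub_nonneg.2 hau))
      (by rw [hab]; exact mul_le_mul_of_nonneg_left (by linarith) hL)
    rw [hab] at hz2
    -- Going through `f a` bounds the distance from above; continuing to `f b` bounds it from below.
    have key1 : ∀ s ∈ F', s ≤ u → dist (f s) z = dist x y * ((u : ℝ) - s) := by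
      intro s hs hsu
      have hsa := hle s hs hsu
      have e1 := hf s hs a ha.1 hsa
      have e2 := hf s hs b hb.1 (hsa.trans (ha.2.le.trans hb.2.le))
      have e3 := dist_triangle (f s) (f a) z
      have e4 := dist_triangle (f s) z (f b)
      rw [e1, hz1] at e3
      rw [e2, hz2] at e4
      linarith
    have key2 : ∀ s ∈ F', u ≤ s → dist z (f s) = dist x y * ((s : ℝ) - u) := by
      intro s hs hsu
      have hbs := hge s hs hsu
      have e1 := hf b hb.1 s hs hbs
      have e2 := hf a ha.1 s hs ((ha.2.le.trans hb.2.le).trans hbs)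
      have e3 := dist_triangle z (f b) (f s)
      have e4 := dist_triangle (f a) z (f s)
      rw [e1, hz2] at e3
      rw [e2, hz1] at e4
      linarith
    have hne : ∀ s ∈ F', s ≠ u := fun s hs h => hu (h ▸ hs)
    refine ⟨Function.update f u z, by rw [Function.update_of_ne u0, h0],
      by rw [Function.update_of_ne u1, h1], ?_⟩
    intro s hs t ht hst
    rcases Finset.mem_insert.1 hs with rfl | hs'
    · rcases Finset.mem_insert.1 ht with rfl | ht'
      · simp
      · rw [Function.update_self, Function.update_of_ne (hne t ht')]
        exact key2 t ht' hst
    · rw [Function.update_of_ne (hne s hs')]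
      rcases Finset.mem_insert.1 ht with rfl | ht'
      · rw [Function.update_self]
        exact key1 s hs' hst
      · rw [Function.update_of_ne (hne t ht')]
        exact hf s hs' t ht' hst

/-- In a compact metrically convex metric space, any two points are joined by a geodesic. -/
theorem HasBetween.exists_geodesic [CompactSpace X] (h : HasBetween X) (x y : X) :
    ∃ f : unitInterval → X, f 0 = x ∧ f 1 = y ∧
      ∀ s t, dist (f s) (f t) = dist x y * |(s : ℝ) - t| := by
  -- These sets are closed in the product space, which is compact by Tychonoff's theorem, and they
  -- are directed; a common point is a geodesic.
  let T : Finset unitInterval → Set (unitInterval → X) := fun F =>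
    {f | f 0 = x ∧ f 1 = y ∧ ∀ s ∈ F, ∀ t ∈ F, s ≤ t →
      dist (f s) (f t) = dist x y * ((t : ℝ) - s)}
  have hT : ∀ F, IsClosed (T F) := by
    intro F
    have : T F = {f | f 0 = x} ∩ ({f | f 1 = y} ∩ ⋂ s ∈ F, ⋂ t ∈ F, ⋂ (_ : s ≤ t),
        {f | dist (f s) (f t) = dist x y * ((t : ℝ) - s)}) := by
      ext f
      simp only [T, mem_inter_iff, mem_iInter, mem_ofPred_eq]
    rw [this]
    refine (isClosed_eq (continuous_apply 0) continuous_const).inter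
      ((isClosed_eq (continuous_apply 1) continuous_const).inter ?_)
    exact isClosed_iInter fun s => isClosed_iInter fun _ => isClosed_iInter fun t =>
      isClosed_iInter fun _ => isClosed_iInter fun _ =>
        isClosed_eq ((continuous_apply s).dist (continuous_apply t)) continuous_const
  have hanti : ∀ F F', F ⊆ F' → T F' ⊆ T F := fun F F' hFF f hf =>
    ⟨hf.1, hf.2.1, fun s hs t ht => hf.2.2 s (hFF hs) t (hFF ht)⟩
  obtain ⟨f, hf⟩ := IsCompact.nonempty_iInter_of_directed_nonempty_isCompact_isClosed T
    (fun F F' => ⟨F ∪ F', hanti _ _ Finset.subset_union_left,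
      hanti _ _ Finset.subset_union_right⟩)
    (fun F => by
      obtain ⟨f, h0, h1, hf⟩ := exists_geodesic_on_finset h x y F
      exact ⟨f, h0, h1, fun s hs t ht => hf s (by simp [hs]) t (by simp [ht])⟩)
    (fun F => (hT F).isCompact) hT
  rw [mem_iInter] at hf
  refine ⟨f, (hf ∅).1, (hf ∅).2.1, fun s t => ?_⟩
  rcases le_total s t with hst | hst
  · rw [(hf {s, t}).2.2 s (by simp) t (by simp) hst, abs_sub_comm,
      abs_of_nonneg (sub_nonneg.2 (show (_ : ℝ) ≤ _ from hst))]
  · rw [dist_comm, (hf {s, t}).2.2 t (by simp) s (by simp) hst,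
      abs_of_nonneg (sub_nonneg.2 (show (_ : ℝ) ≤ _ from hst))]

end Geodesic

end GraphEnds

namespace GraphEnds

universe u

variable {V : Type u} {G : SimpleGraph V}

namespace EndSpace

/-! ### Arcs and their lengths -/

/-- The parameters of the points in which the edge `e` meets `A`. -/
def edgeTrace (e : G.edgeSet) (A : Set (EndSpace G)) : Set ℝ :=
  {t : ℝ | t ∈ Icc (0 : ℝ) 1 ∧ edgePt e t ∈ A}

theorem isClosed_edgeTrace (e : G.edgeSet) {A : Set (EndSpace G)} (hA : IsClosed A) :
    IsClosed (edgeTrace e A) :=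
  isClosed_Icc.inter (hA.preimage (continuous_edgePt e))

theorem isArc_image_Icc {f : unitInterval → EndSpace G} (hf : IsEmbedding f) {s t : unitInterval}
    (hst : s ≤ t) : IsArc (f s) (f t) (f '' Icc s t) := by
  rcases eq_or_lt_of_le hst with rfl | hlt
  · exact Or.inr ⟨rfl, by simp⟩
  have hlt' : (0 : ℝ) < t - s := sub_pos.2 hlt
  have hs := s.2
  have ht := t.2
  have hmem : ∀ u : unitInterval, (s : ℝ) + u * (t - s) ∈ Icc (s : ℝ) t := by
    intro u
    have h1 := u.2.1
    have h2 := u.2.2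
    constructor <;> nlinarith
  let g : unitInterval → unitInterval := fun u =>
    ⟨(s : ℝ) + u * (t - s), hs.1.trans (hmem u).1, (hmem u).2.trans ht.2⟩
  have hg : Continuous g := by
    refine Continuous.subtype_mk ?_ _
    fun_prop
  have hinj : Function.Injective g := by
    intro u v huv
    have h : (s : ℝ) + u * (t - s) = s + v * (t - s) := congrArg Subtype.val huv
    exact Subtype.ext (mul_right_cancel₀ hlt'.ne' (add_left_cancel h))
  have hg0 : g 0 = s := Subtype.ext (by simp [g])
  have hg1 : g 1 = t := Subtype.ext (by simp [g])
  have hrange : range g = Icc s t := by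
    ext v
    constructor
    · rintro ⟨u, rfl⟩
      exact hmem u
    · rintro ⟨h1, h2⟩
      have h1' : (s : ℝ) ≤ v := h1
      have h2' : (v : ℝ) ≤ t := h2
      refine ⟨⟨((v : ℝ) - s) / (t - s), div_nonneg (by linarith) hlt'.le,
        (div_le_one hlt').2 (by linarith)⟩, Subtype.ext ?_⟩
      simp only [g]
      field_simp
      ring
  exact Or.inl ⟨f ∘ g, hf.comp (hg.isClosedEmbedding hinj).isEmbedding, by simp [hg0],
    by simp [hg1], by rw [range_comp, hrange]⟩

theorem IsArc.isPreconnected {x y : EndSpace G} {A : Set (EndSpace G)} (h : IsArc x y A) :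
    IsPreconnected A := by
  rcases h with ⟨f, hf, -, -, rfl⟩ | ⟨-, rfl⟩
  · exact isPreconnected_range hf.continuous
  · exact isPreconnected_singleton

theorem IsArc.left_mem {x y : EndSpace G} {A : Set (EndSpace G)} (h : IsArc x y A) : x ∈ A := by
  rcases h with ⟨f, -, rfl, -, rfl⟩ | ⟨-, rfl⟩
  · exact mem_range_self 0
  · rfl

theorem IsArc.right_mem {x y : EndSpace G} {A : Set (EndSpace G)} (h : IsArc x y A) :
    y ∈ A := by
  rcases h with ⟨f, -, -, rfl, rfl⟩ | ⟨rfl, rfl⟩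
  · exact mem_range_self 1
  · rfl

/-- Each edge is parametrized injectively, so the one common point gives at most one common
parameter, a null set. -/
theorem arcLength_add_le (ℓ : G.edgeSet → ℝ) {A B C : Set (EndSpace G)} {z : EndSpace G}
    (hB : IsClosed B) (hAC : A ⊆ C) (hBC : B ⊆ C) (hAB : A ∩ B ⊆ {z}) :
    arcLength ℓ A + arcLength ℓ B ≤ arcLength ℓ C := by
  rw [arcLength, arcLength, arcLength, ← ENNReal.tsum_add]
  refine ENNReal.tsum_le_tsum fun e => ?_
  rw [← mul_add]
  refine mul_le_mul_right ?_ _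
  change volume (edgeTrace e A) + volume (edgeTrace e B) ≤ volume (edgeTrace e C)
  have hdisj : AEDisjoint volume (edgeTrace e A) (edgeTrace e B) := by
    refine Set.Subsingleton.measure_zero (fun s hs t ht => ?_) _
    have h1 : edgePt e s = z := hAB ⟨hs.1.2, hs.2.2⟩
    have h2 : edgePt e t = z := hAB ⟨ht.1.2, ht.2.2⟩
    exact injOn_edgePt e hs.1.1 ht.1.1 (h1.trans h2.symm)
  rw [← measure_union₀ (isClosed_edgeTrace e hB).measurableSet.nullMeasurableSet hdisj]
  refine measure_mono (union_subset ?_ ?_)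
  · exact fun t ht => ⟨ht.1, hAC ht.2⟩
  · exact fun t ht => ⟨ht.1, hBC ht.2⟩

theorem arcDist_le (ℓ : G.edgeSet → ℝ) {x y : EndSpace G} {A : Set (EndSpace G)}
    (h : IsArc x y A) : arcDist ℓ x y ≤ arcLength ℓ A :=
  iInf₂_le A h

theorem exists_isArc_of_arcDist_lt {ℓ : G.edgeSet → ℝ} {x y : EndSpace G} {c : ℝ≥0∞}
    (h : arcDist ℓ x y < c) : ∃ A, IsArc x y A ∧ arcLength ℓ A < c := by
  simpa [arcDist, iInf_lt_iff] using h

theorem preconnectedSpace_of_arcDist_ne_top {ℓ : G.edgeSet → ℝ}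
    (h : ∀ x y : EndSpace G, arcDist ℓ x y ≠ ∞) : PreconnectedSpace (EndSpace G) := by
  refine ⟨isPreconnected_of_forall_pair fun x _ y _ => ?_⟩
  obtain ⟨A, hA, -⟩ := exists_isArc_of_arcDist_lt (h x y).lt_top
  exact ⟨A, subset_univ _, hA.left_mem, hA.right_mem, hA.isPreconnected⟩

/-- By the intermediate value theorem an arc of length below `d p q + ε` has a point at distance `s`
from `p`. Cutting there, the lengths of the two pieces bound the distances to `p` and `q`. -/
theorem exists_approx_between [T2Space (EndSpace G)] {ℓ : G.edgeSet → ℝ}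
    (m : MetricSpace (EndSpace G)) (hd : ∀ x y, arcDist ℓ x y = ENNReal.ofReal (m.dist x y))
    (hm : ∀ p, Continuous fun z => m.dist p z) {p q : EndSpace G} {s ε : ℝ} (hs : 0 ≤ s)
    (hs' : s ≤ m.dist p q) (hε : 0 < ε) :
    ∃ z, m.dist p z = s ∧ m.dist z q ≤ m.dist p q - s + ε := by
  have hnn : ∀ a b, 0 ≤ m.dist a b := fun a b => @dist_nonneg _ m.toPseudoMetricSpace a b
  have h : arcDist ℓ p q < ENNReal.ofReal (m.dist p q + ε) := by
    rw [hd]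
    exact (ENNReal.ofReal_lt_ofReal_iff (by linarith [hnn p q])).2 (by linarith)
  obtain ⟨A, hA, hlen⟩ := exists_isArc_of_arcDist_lt h
  rcases hA with ⟨f, hf, rfl, rfl, rfl⟩ | ⟨rfl, rfl⟩
  · obtain ⟨u, hu⟩ : s ∈ range fun u => m.dist (f 0) (f u) :=
      mem_range_of_exists_le_of_exists_ge ((hm (f 0)).comp hf.continuous)
        ⟨0, by rw [show m.dist (f 0) (f 0) = 0 from m.dist_self _]; exact hs⟩ ⟨1, hs'⟩
    refine ⟨f u, hu, ?_⟩
    have hA1 := isArc_image_Icc hf (unitInterval.nonneg' (t := u))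
    have hA2 := isArc_image_Icc hf (unitInterval.le_one' (t := u))
    have hadd := arcLength_add_le ℓ (A := f '' Icc 0 u) (B := f '' Icc u 1) (C := range f)
      (z := f u) (isCompact_Icc.image hf.continuous).isClosed (image_subset_range _ _)
      (image_subset_range _ _) (by
        rintro _ ⟨⟨a, ha, rfl⟩, b, hb, hab⟩
        obtain rfl := hf.injective hab
        rw [le_antisymm ha.2 hb.1]
        rfl)
    have h1 := (add_le_add (arcDist_le ℓ hA1) (arcDist_le ℓ hA2)).trans_lt (hadd.trans_lt hlen)
    rw [hd, hd, ← ENNReal.ofReal_add (hnn _ _) (hnn _ _),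
      ENNReal.ofReal_lt_ofReal_iff (by linarith [hnn (f 0) (f 1)])] at h1
    have hu' : m.dist (f 0) (f u) = s := hu
    linarith
  · rw [m.dist_self] at hs' ⊢
    obtain rfl := le_antisymm hs' hs
    exact ⟨p, m.dist_self p, by rw [m.dist_self]; linarith⟩

/-! ### Distances along an edge -/

/-- The open segment and the complement of the closed segment are disjoint open sets covering `A`,
so connectedness confines `A` to the first. -/
theorem subset_edgePt_image_Ioo [T2Space (EndSpace G)] {A : Set (EndSpace G)}
    (hA : IsPreconnected A) (e : G.edgeSet) {a b c : ℝ} (ha : 0 ≤ a) (hb : b ≤ 1)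
    (hc : c ∈ Ioo a b) (hcA : edgePt e c ∈ A) (haA : edgePt e a ∉ A) (hbA : edgePt e b ∉ A) :
    A ⊆ edgePt e '' Ioo a b := by
  have hcl : IsClosed (edgePt e '' Icc a b) :=
    (isCompact_Icc.image (continuous_edgePt e)).isClosed
  refine hA.subset_left_of_subset_union (isOpen_edgePt_image_Ioo e ha hb) hcl.isOpen_compl
    (disjoint_compl_right_iff_subset.2 (image_mono Ioo_subset_Icc_self)) (fun q hq => ?_)
    ⟨_, hcA, c, hc, rfl⟩
  by_cases hq' : q ∈ edgePt e '' Icc a b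
  · obtain ⟨t, ht, rfl⟩ := hq'
    refine Or.inl ⟨t, ⟨lt_of_le_of_ne ht.1 ?_, lt_of_le_of_ne ht.2 ?_⟩, rfl⟩
    · rintro rfl; exact haA hq
    · rintro rfl; exact hbA hq
  · exact Or.inr hq'

/-- Either `A` covers the segment from `s` to `t`, or it covers the rest of the edge, of measure `1
- (t - s) ≥ t - s`. Were a point `w` of the first and a point `v` of the second both missing, `A`
would be trapped between them with only one of its two given points. -/
theorem ofReal_le_volume_edgeTrace [T2Space (EndSpace G)] {A : Set (EndSpace G)}
    (hA : IsPreconnected A) (e : G.edgeSet) {s t : ℝ} (hs : 0 < s) (hst : s < t) (ht : t < 1)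
    (hst' : t - s ≤ 1 / 2) (hsA : edgePt e s ∈ A) (htA : edgePt e t ∈ A) :
    ENNReal.ofReal (t - s) ≤ volume (edgeTrace e A) := by
  by_cases h1 : Ioo s t ⊆ edgeTrace e A
  · rw [← Real.volume_Ioo]
    exact measure_mono h1
  have h2 : Ioo 0 s ∪ Ioo t 1 ⊆ edgeTrace e A := by
    intro v hv
    have hv1 : v ∈ Icc (0 : ℝ) 1 := by
      rcases hv with hv | hv
      · exact ⟨hv.1.le, by linarith [hv.2]⟩
      · exact ⟨by linarith [hv.1], hv.2.le⟩
    refine ⟨hv1, by_contra fun hvA => ?_⟩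
    obtain ⟨w, hw, hw'⟩ := not_subset.1 h1
    have hwA : edgePt e w ∉ A := fun h => hw' ⟨⟨by linarith [hw.1], by linarith [hw.2]⟩, h⟩
    rcases hv with hv | hv
    · have := subset_edgePt_image_Ioo hA e hv.1.le (by linarith [hw.2] : w ≤ 1)
        ⟨hv.2, hw.1⟩ hsA hvA hwA
      obtain ⟨c, hc, hc'⟩ := this htA
      rw [edgePt_eq_edgePt_iff ⟨by linarith, ht⟩] at hc'
      linarith [hc.2, hw.2, hc'.2]
    · have := subset_edgePt_image_Ioo hA e (by linarith [hw.1] : 0 ≤ w) hv.2.le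
        ⟨hw.2, hv.1⟩ htA hwA hvA
      obtain ⟨c, hc, hc'⟩ := this hsA
      rw [edgePt_eq_edgePt_iff ⟨hs, by linarith⟩] at hc'
      linarith [hc.1, hw.1, hc'.2]
  refine le_trans ?_ (measure_mono h2)
  rw [measure_union _ measurableSet_Ioo, Real.volume_Ioo, Real.volume_Ioo,
    ← ENNReal.ofReal_add (by linarith) (by linarith)]
  · exact ENNReal.ofReal_le_ofReal (by linarith)
  · exact Set.disjoint_left.2 fun v h h' => by linarith [h.2, h'.1]

theorem mul_abs_sub_le_dist_edgePt [T2Space (EndSpace G)] {ℓ : G.edgeSet → ℝ}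
    (hℓ : ∀ e, 0 < ℓ e) (m : MetricSpace (EndSpace G))
    (hd : ∀ x y, arcDist ℓ x y = ENNReal.ofReal (m.dist x y)) (e : G.edgeSet) {s t : ℝ}
    (hs : s ∈ Ioo (0 : ℝ) 1) (ht : t ∈ Ioo (0 : ℝ) 1) (hst : |s - t| ≤ 1 / 2) :
    ℓ e * |s - t| ≤ m.dist (edgePt e s) (edgePt e t) := by
  wlog hle : s ≤ t generalizing s t
  · have := this ht hs (by rwa [abs_sub_comm]) (le_of_not_ge hle)
    rwa [abs_sub_comm, m.dist_comm] at this
  have hnn : 0 ≤ m.dist (edgePt e s) (edgePt e t) :=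
    @dist_nonneg _ m.toPseudoMetricSpace _ _
  rcases eq_or_lt_of_le hle with rfl | hlt
  · simp
  rw [abs_sub_comm, abs_of_pos (sub_pos.2 hlt)] at hst ⊢
  rw [← ENNReal.ofReal_le_ofReal_iff hnn, ← hd, ENNReal.ofReal_mul (hℓ e).le]
  refine le_iInf₂ fun A hA => ?_
  calc ENNReal.ofReal (ℓ e) * ENNReal.ofReal (t - s)
      ≤ ENNReal.ofReal (ℓ e) * volume (edgeTrace e A) := by
        refine mul_le_mul_right ?_ _
        exact ofReal_le_volume_edgeTrace hA.isPreconnected e hs.1 hlt ht.2 hst hA.left_mem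
          hA.right_mem
    _ ≤ arcLength ℓ A :=
        ENNReal.le_tsum (f := fun e => ENNReal.ofReal (ℓ e) * volume (edgeTrace e A)) e

/-! ### The length of a geodesic -/

/-- The parameters, in `[0, 1]`, at which the path `f` runs in `U`. -/
def pathTrace (f : unitInterval → EndSpace G) (U : Set (EndSpace G)) : Set ℝ :=
  Icc 0 1 ∩ (fun t => f (projIcc 0 1 zero_le_one t)) ⁻¹' U

theorem measurableSet_pathTrace {f : unitInterval → EndSpace G} (hf : Continuous f)
    {U : Set (EndSpace G)} (hU : IsOpen U) : MeasurableSet (pathTrace f U) :=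
  measurableSet_Icc.inter (hU.preimage (hf.comp continuous_projIcc)).measurableSet

/-- While `f` runs in `J`, its edge coordinate `h` is an `L / ℓ e`-Lipschitz function of time, and
such a map enlarges one-dimensional Hausdorff measure, here Lebesgue measure, by at most this
factor. -/
theorem mul_volume_edgeTrace_inter_le [T2Space (EndSpace G)] {ℓ : G.edgeSet → ℝ}
    (hℓ : ∀ e, 0 < ℓ e) (m : MetricSpace (EndSpace G))
    (hd : ∀ x y, arcDist ℓ x y = ENNReal.ofReal (m.dist x y)) {f : unitInterval → EndSpace G}
    {L : ℝ} (hL : 0 ≤ L) (hf : ∀ s t, m.dist (f s) (f t) = L * |(s : ℝ) - t|) (e : G.edgeSet)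
    {J : Set ℝ} (hJ : J ⊆ Ioo 0 1) (hJ' : ∀ s ∈ J, ∀ t ∈ J, |s - t| ≤ 1 / 2) :
    ENNReal.ofReal (ℓ e) * volume (edgeTrace e (range f) ∩ J) ≤
      ENNReal.ofReal L * volume (pathTrace f (edgePt e '' J)) := by
  set W := pathTrace f (edgePt e '' J) with hW
  let h : ℝ → ℝ := fun u => Function.invFunOn (edgePt e) J (f (projIcc 0 1 zero_le_one u))
  have hh : ∀ u ∈ W, h u ∈ J ∧ edgePt e (h u) = f (projIcc 0 1 zero_le_one u) :=
    fun u hu => ⟨Function.invFunOn_mem hu.2, Function.invFunOn_eq hu.2⟩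
  have hlip : LipschitzOnWith (Real.toNNReal (L / ℓ e)) h W := by
    refine LipschitzOnWith.of_dist_le_mul fun u hu v hv => ?_
    have h1 := mul_abs_sub_le_dist_edgePt hℓ m hd e (hJ (hh u hu).1) (hJ (hh v hv).1)
      (hJ' _ (hh u hu).1 _ (hh v hv).1)
    rw [(hh u hu).2, (hh v hv).2, hf, projIcc_of_mem _ hu.1, projIcc_of_mem _ hv.1] at h1
    rw [Real.coe_toNNReal _ (div_nonneg hL (hℓ e).le), Real.dist_eq, Real.dist_eq,
      div_mul_eq_mul_div, le_div_iff₀ (hℓ e), mul_comm]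
    exact h1
  have hsub : edgeTrace e (range f) ∩ J ⊆ h '' W := by
    rintro t ⟨⟨-, u, hu⟩, htJ⟩
    have hproj : projIcc 0 1 zero_le_one (u : ℝ) = u := projIcc_val _ u
    have huW : (u : ℝ) ∈ W := ⟨u.2, by rw [mem_preimage, hproj, hu]; exact ⟨t, htJ, rfl⟩⟩
    refine ⟨u, huW, ?_⟩
    have h1 := (hh u huW).2
    rw [hproj, hu, edgePt_eq_edgePt_iff (hJ htJ)] at h1
    exact h1.2
  have hvol := hlip.hausdorffMeasure_image_le (d := 1) zero_le_one
  rw [hausdorffMeasure_real, ENNReal.rpow_one] at hvol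
  calc ENNReal.ofReal (ℓ e) * volume (edgeTrace e (range f) ∩ J)
      ≤ ENNReal.ofReal (ℓ e) * (ENNReal.ofReal (L / ℓ e) * volume W) :=
        mul_le_mul_right ((measure_mono hsub).trans hvol) _
    _ = ENNReal.ofReal L * volume W := by
        rw [← mul_assoc, ← ENNReal.ofReal_mul (hℓ e).le, mul_div_cancel₀ _ (hℓ e).ne']

/-- The distance bound holds only for coordinates at most `1 / 2` apart, so the edge is treated in
two open halves; the three omitted parameters form a null set. -/
theorem mul_volume_edgeTrace_le [T2Space (EndSpace G)] {ℓ : G.edgeSet → ℝ}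
    (hℓ : ∀ e, 0 < ℓ e) (m : MetricSpace (EndSpace G))
    (hd : ∀ x y, arcDist ℓ x y = ENNReal.ofReal (m.dist x y)) {f : unitInterval → EndSpace G}
    (hfc : Continuous f) {L : ℝ} (hL : 0 ≤ L)
    (hf : ∀ s t, m.dist (f s) (f t) = L * |(s : ℝ) - t|) (e : G.edgeSet) :
    ENNReal.ofReal (ℓ e) * volume (edgeTrace e (range f)) ≤
      ENNReal.ofReal L * volume (pathTrace f (edgePt e '' Ioo 0 1)) := by
  have hJ₁ : Ioo (0 : ℝ) (1 / 2) ⊆ Ioo 0 1 := Ioo_subset_Ioo_right (by norm_num)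
  have hJ₂ : Ioo (1 / 2 : ℝ) 1 ⊆ Ioo 0 1 := Ioo_subset_Ioo_left (by norm_num)
  have h1 := mul_volume_edgeTrace_inter_le hℓ m hd hL hf e hJ₁
    fun s hs t ht => by rw [abs_le]; constructor <;> linarith [hs.1, hs.2, ht.1, ht.2]
  have h2 := mul_volume_edgeTrace_inter_le hℓ m hd hL hf e hJ₂
    fun s hs t ht => by rw [abs_le]; constructor <;> linarith [hs.1, hs.2, ht.1, ht.2]
  have hsub : edgeTrace e (range f) ⊆ ((edgeTrace e (range f) ∩ Ioo 0 (1 / 2)) ∪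
      (edgeTrace e (range f) ∩ Ioo (1 / 2) 1)) ∪ {0, 1 / 2, 1} := by
    intro t ht
    have h0 := ht.1.1
    have h1 := ht.1.2
    by_cases hmem : t ∈ ({0, 1 / 2, 1} : Set ℝ)
    · exact Or.inr hmem
    · simp only [mem_insert_iff, mem_singleton_iff, not_or] at hmem
      rcases lt_or_gt_of_ne hmem.2.1 with h | h
      · exact Or.inl (Or.inl ⟨ht, lt_of_le_of_ne h0 (Ne.symm hmem.1), h⟩)
      · exact Or.inl (Or.inr ⟨ht, h, lt_of_le_of_ne h1 hmem.2.2⟩)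
  have hnull : volume ({0, 1 / 2, 1} : Set ℝ) = 0 := (toFinite _).measure_zero _
  have hvol : volume (edgeTrace e (range f)) ≤ volume (edgeTrace e (range f) ∩ Ioo 0 (1 / 2)) +
      volume (edgeTrace e (range f) ∩ Ioo (1 / 2) 1) := by
    refine (measure_mono hsub).trans ((measure_union_le _ _).trans ?_)
    rw [hnull, add_zero]
    exact measure_union_le _ _
  have hdisj : Disjoint (pathTrace f (edgePt e '' Ioo 0 (1 / 2)))
      (pathTrace f (edgePt e '' Ioo (1 / 2) 1)) := by
    refine Set.disjoint_left.2 fun u hu hu' => ?_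
    obtain ⟨s, hs, hs'⟩ := hu.2
    obtain ⟨t, ht, ht'⟩ := hu'.2
    have := ((edgePt_eq_edgePt_iff (hJ₂ ht)).1 (hs'.trans ht'.symm)).2
    linarith [hs.2, ht.1]
  calc ENNReal.ofReal (ℓ e) * volume (edgeTrace e (range f))
      ≤ _ := mul_le_mul_right hvol _
    _ = _ := mul_add _ _ _
    _ ≤ _ := add_le_add h1 h2
    _ = ENNReal.ofReal L * volume (pathTrace f (edgePt e '' Ioo 0 (1 / 2)) ∪
          pathTrace f (edgePt e '' Ioo (1 / 2) 1)) := by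
        rw [← mul_add, measure_union hdisj (measurableSet_pathTrace hfc
          (isOpen_edgePt_image_Ioo e (by norm_num) le_rfl))]
    _ ≤ _ := by
        refine mul_le_mul_right (measure_mono (union_subset ?_ ?_)) _
        · exact fun u hu => ⟨hu.1, image_mono hJ₁ hu.2⟩
        · exact fun u hu => ⟨hu.1, image_mono hJ₂ hu.2⟩

theorem arcLength_range_le [T2Space (EndSpace G)] {ℓ : G.edgeSet → ℝ}
    (hℓ : ∀ e, 0 < ℓ e) (m : MetricSpace (EndSpace G))
    (hd : ∀ x y, arcDist ℓ x y = ENNReal.ofReal (m.dist x y)) {f : unitInterval → EndSpace G}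
    (hfc : Continuous f) {L : ℝ} (hL : 0 ≤ L)
    (hf : ∀ s t, m.dist (f s) (f t) = L * |(s : ℝ) - t|) :
    arcLength ℓ (range f) ≤ ENNReal.ofReal L := by
  have hmeas : ∀ e : G.edgeSet, MeasurableSet (pathTrace f (edgePt e '' Ioo 0 1)) := fun e =>
    measurableSet_pathTrace hfc (isOpen_edgePt_image_Ioo e le_rfl le_rfl)
  have hdisj : Pairwise (Function.onFun Disjoint
      fun e : G.edgeSet => pathTrace f (edgePt e '' Ioo 0 1)) := by
    intro e e' hne
    refine Set.disjoint_left.2 fun u hu hu' => hne ?_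
    obtain ⟨s, hs, hs'⟩ := hu.2
    obtain ⟨t, ht, ht'⟩ := hu'.2
    exact ((edgePt_eq_edgePt_iff ht).1 (hs'.trans ht'.symm)).1
  calc arcLength ℓ (range f)
      ≤ ∑' e : G.edgeSet, ENNReal.ofReal L * volume (pathTrace f (edgePt e '' Ioo 0 1)) :=
        ENNReal.tsum_le_tsum fun e => mul_volume_edgeTrace_le hℓ m hd hfc hL hf e
    _ = ENNReal.ofReal L * ∑' e : G.edgeSet, volume (pathTrace f (edgePt e '' Ioo 0 1)) :=
        ENNReal.tsum_mul_left
    _ ≤ ENNReal.ofReal L * volume (Icc (0 : ℝ) 1) := by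
        refine mul_le_mul_right ((tsum_meas_le_meas_iUnion_of_disjoint _ hmeas hdisj).trans
          (measure_mono (iUnion_subset fun e u hu => hu.1))) _
    _ = ENNReal.ofReal L := by simp

/-- In a metric representation of a locally finite graph, any two points of `|G|` are joined by
a shortest arc. -/
theorem IsMetricRepresentation.exists_shortest_arc {ℓ : G.edgeSet → ℝ}
    (h : IsMetricRepresentation G ℓ) (hG : ∀ v, (G.neighborSet v).Finite) [Nonempty V]
    (x y : EndSpace G) (hxy : x ≠ y) : ∃ A, IsArc x y A ∧ arcLength ℓ A = arcDist ℓ x y := by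
  obtain ⟨hℓ, m, hd, htop⟩ := h
  -- The topology of `M` is definitionally that of `|G|`, so compactness and metric arguments refer
  -- to the same topology.
  let M : MetricSpace (EndSpace G) := m.replaceTopology htop.symm
  have hM : ∀ a b : EndSpace G, arcDist ℓ a b = ENNReal.ofReal (M.dist a b) := hd
  have : PreconnectedSpace (EndSpace G) :=
    preconnectedSpace_of_arcDist_ne_top (ℓ := ℓ) fun a b => by
      rw [hd]; exact ENNReal.ofReal_ne_top
  have : CompactSpace (EndSpace G) := compactSpace connected_of_preconnectedSpace hG
  have hbetween : HasBetween (EndSpace G) := fun p q s hs hs' =>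
    exists_between_of_approx fun ε hε => exists_approx_between M hM
      (fun p => continuous_const.dist continuous_id) hs hs' hε
  obtain ⟨f, h0, h1, hf⟩ := hbetween.exists_geodesic x y
  have hpos : 0 < dist x y := dist_pos.2 hxy
  have hfc : Continuous f := by
    refine (LipschitzWith.of_dist_le_mul (K := Real.toNNReal (dist x y)) fun s t => ?_).continuous
    rw [hf, Real.coe_toNNReal _ hpos.le]
    rfl
  have hinj : Function.Injective f := by
    intro s t hst
    have := hf s t
    rw [hst, dist_self, zero_eq_mul, or_iff_right hpos.ne', abs_eq_zero, sub_eq_zero] at this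
    exact Subtype.ext this
  have harc : IsArc x y (range f) :=
    Or.inl ⟨f, (hfc.isClosedEmbedding hinj).isEmbedding, h0, h1, rfl⟩
  refine ⟨range f, harc, le_antisymm ?_ (arcDist_le ℓ harc)⟩
  rw [hM]
  exact arcLength_range_le hℓ M hM hfc hpos.le hf

end EndSpace

end GraphEnds

theorem proposition5p2 {V : Type*} (G : SimpleGraph V)
    (hG : ∀ v, (G.neighborSet v).Finite)
    (ℓ : G.edgeSet → ℝ) (hℓ : GraphEnds.EndSpace.IsMetricRepresentation G ℓ)
    (x y : GraphEnds.EndSpace G)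
    (hx : x ∈ GraphEnds.EndSpace.verticesAndEnds G)
    (hy : y ∈ GraphEnds.EndSpace.verticesAndEnds G) (hxy : x ≠ y) :
    ∃ A : Set (GraphEnds.EndSpace G),
      GraphEnds.EndSpace.IsArc x y A ∧
        GraphEnds.EndSpace.arcLength ℓ A = GraphEnds.EndSpace.arcDist ℓ x y := by
  -- Connectedness of a graph includes having a vertex; an end supplies one through any of its rays.
  have : Nonempty V := by
    rcases hx with ⟨v, -⟩ | ⟨ω, -⟩
    · exact ⟨v⟩
    · exact ⟨(Quotient.out ω).vert 0⟩
  exact hℓ.exists_shortest_arc hG x y hxy
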